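/- Let $G=\prod_{i=1}^{d}\alpha_i\mathbf Z\times\prod_{j=1}^{e}\mathbf Z/n_j\mathbf Z$ with $d,e\ge 0$, real $\alpha_i>0$ and integers $n_j\ge 1$. For $g=(x_1,\dots,x_d,m_1,\dots,m_e)\in G$ put $|g|=\max\{|x_1|,\dots,|x_d|,\delta(m_1),\dots,\delta(m_e)\}$ (with value $0$ if $d=e=0$), where $\delta(m)=0$ if $m=0$ and $\delta(m)=1$ otherwise. For $j\in G$ and an integer $N\ge 0$ let $S_N(j)=\{k\in G:|k-j|\le N/2\}$. Let $I$ be a countable set and $a\colon I\to G$ a map, with upper density $$D^+(I,a)=\limsup_{N\to\infty}\,\sup_{j\in G}\frac{|a^{-1}(S_N(j))|}{|S_N(j)|}\in[0,\infty].$$ Let $H$ be a separable complex Hilbert space and let $\mathcal F=\{f_i\}_{i\in I}$ be a frame for $H$, i.e. there are $A,B>0$ with $A\|f\|^2\le\sum_{i\in I}|\langle f,f_i\rangle|^2\le B\|f\|^2$ for all $f\in H$. Let $Sf=\sum_{i\in I}\langle f,f_i\rangle f_i$ be its frame operator (a bounded, positive, invertible operator on $H$), $\tilde{\mathcal F}=\{\tilde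 f_i\}_{i\in I}$ with $\tilde f_i=S^{-1}f_i$ its canonical dual frame, and $S^{-1/2}(\mathcal F)=\{S^{-1/2}f_i\}_{i\in I}$ its canonical Parseval frame. A sequence $\{g_i\}_{i\in I}$ in $H$ is called $\ell^1$-self-localized (with respect to $a$) if there is $r\in\ell^1(G)$ such that $|\langle g_i,g_j\rangle|\le r_{a(i)-a(j)}$ for all $i,j\in I$. The frame $\mathcal F$ is called $\ell^1$-localized with respect to its canonical dual frame (and $a$) if there is $r\in\ell^1(G)$ such that $|\langle f_i,\tilde f_j\rangle|\le r_{a(i)-a(j)}$ for all $i,j\in I$. **Theorem.** Suppose that $D^+(I,a)<\infty$ and that $(\mathcal F,a)$ is $\ell^1$-self-localized. Then (a) $(\mathcal F,a)$ is $\ell^1$-localized with respect to its canonical dual frame $\tilde{\mathcal F}$; (b) $(\tilde{\mathcal F},a)$ is $\ell^1$-self-localized; and (c) $(S^{-1/2}(\mathcal F),a)$ is $\ell^1$-self-localized. -/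

import Mathlib

open scoped ENNReal NNReal

noncomputable section

namespace LocalizedFrames

/-! ### The reference group and density -/

/-- The reference group `∏ i, α i ℤ × ∏ j, ℤ / n j`, where `α i ℤ` is the subgroup of `ℝ`
generated by `α i`. -/
abbrev RefGroup {d e : ℕ} (α : Fin d → ℝ) (n : Fin e → ℕ) : Type :=
  (∀ i, AddSubgroup.zmultiples (α i)) × (∀ j, ZMod (n j))

section Density

variable {d e : ℕ} {α : Fin d → ℝ} {n : Fin e → ℕ}

/-- The size `|g|` of a group element: the largest of the absolute values of its real
coordinates and of the numbers `δ (m j)`, where `δ m = 0` if `m = 0` and `δ m = 1` otherwise. -/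
def size (g : RefGroup α n) : ℝ≥0 :=
  max (Finset.univ.sup fun i => ‖(g.1 i : ℝ)‖₊)
    (Finset.univ.sup fun j => if g.2 j = 0 then 0 else 1)

/-- The box `S_N(j) = {k : |k - j| ≤ N / 2}`. -/
def box (N : ℕ) (j : RefGroup α n) : Set (RefGroup α n) :=
  {k | (size (k - j) : ℝ) ≤ (N : ℝ) / 2}

/-- The upper density `D⁺(I, a) = limsup_N sup_j |a⁻¹(S_N(j))| / |S_N(j)|`, in `[0, ∞]`.
Points of `I` are counted with multiplicity. -/
def upperDensity {I : Type*} (a : I → RefGroup α n) : ℝ≥0∞ :=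
  Filter.limsup
    (fun N : ℕ => ⨆ j : RefGroup α n,
      ((a ⁻¹' box N j).encard : ℝ≥0∞) / ((box N j).encard : ℝ≥0∞))
    Filter.atTop

/-- Boxes are finite, so that the quotients in the density are genuine. -/
theorem box_finite (hn : ∀ j, 0 < n j) (N : ℕ) (j : RefGroup α n) : (box N j).Finite := by
  have : ∀ j, NeZero (n j) := fun j => ⟨(hn j).ne'⟩
  have key : ∀ (c x : ℝ),
      {y : AddSubgroup.zmultiples c | |(y : ℝ) - x| ≤ (N : ℝ) / 2}.Finite := by
    intro c x
    have hd : DiscreteTopology (AddSubgroup.zmultiples c : Set ℝ) :=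
      inferInstanceAs (DiscreteTopology (AddSubgroup.zmultiples c))
    have h := Metric.finite_isBounded_inter_isClosed
      ⟨hd⟩
      (Metric.isBounded_closedBall (x := x) (r := (N : ℝ) / 2))
      (AddSubgroup.isClosed_of_discrete (H := AddSubgroup.zmultiples c))
    refine Set.Finite.of_finite_image (f := Subtype.val) (h.subset ?_)
      Subtype.val_injective.injOn
    rintro _ ⟨y, hy, rfl⟩
    exact ⟨by simpa [Real.dist_eq] using hy, y.2⟩
  refine ((Set.Finite.pi' fun i => key (α i) (j.1 i)).prod
    (Set.toFinite (Set.univ : Set (∀ j, ZMod (n j))))).subset ?_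
  intro k hk
  refine ⟨fun i => ?_, Set.mem_univ _⟩
  have h1 : ‖((k - j).1 i : ℝ)‖₊ ≤ size (k - j) :=
    le_max_of_le_left
      (Finset.le_sup (f := fun i => ‖((k - j).1 i : ℝ)‖₊) (Finset.mem_univ i))
  have h2 : ‖((k - j).1 i : ℝ)‖ ≤ size (k - j) := by exact_mod_cast h1
  exact (by simpa using h2 : |(k.1 i : ℝ) - j.1 i| ≤ _).trans hk

end Density

/-! ### Frames -/

section Frames

variable {H : Type*} [NormedAddCommGroup H] [InnerProductSpace ℂ H] {I : Type*}

/-- `f` is a frame for `H`: there are `A, B > 0` with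
`A ‖x‖² ≤ ∑ i, |⟨x, f i⟩|² ≤ B ‖x‖²` for all `x`, the sum being convergent. -/
def IsFrame (f : I → H) : Prop :=
  ∃ A B : ℝ, 0 < A ∧ 0 < B ∧ ∀ x : H,
    Summable (fun i => ‖inner ℂ (f i) x‖ ^ 2) ∧
    A * ‖x‖ ^ 2 ≤ ∑' i, ‖inner ℂ (f i) x‖ ^ 2 ∧
    ∑' i, ‖inner ℂ (f i) x‖ ^ 2 ≤ B * ‖x‖ ^ 2

theorem IsFrame.memℓp {f : I → H} (hf : IsFrame f) (x : H) :
    Memℓp (fun i => inner ℂ (f i) x) 2 := by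
  obtain ⟨A, B, -, -, h⟩ := hf
  refine memℓp_gen ?_
  simpa using (h x).1

theorem IsFrame.norm_sq {f : I → H} (hf : IsFrame f) (x : H) :
    ‖(⟨fun i => inner ℂ (f i) x, hf.memℓp x⟩ : lp (fun _ : I => ℂ) 2)‖ ^ 2
      = ∑' i, ‖inner ℂ (f i) x‖ ^ 2 := by
  have h := lp.norm_rpow_eq_tsum (p := 2) (by norm_num)
    (⟨fun i => inner ℂ (f i) x, hf.memℓp x⟩ : lp (fun _ : I => ℂ) 2)
  simpa using h

/-- The analysis operator `T x = (⟨x, f i⟩)_i` of a frame, from `H` to `ℓ²(I)`.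
(Mathlib's inner product is linear in the second variable.) -/
def analysis (f : I → H) (hf : IsFrame f) : H →L[ℂ] lp (fun _ : I => ℂ) 2 :=
  LinearMap.mkContinuousOfExistsBound
    { toFun := fun x => ⟨fun i => inner ℂ (f i) x, hf.memℓp x⟩
      map_add' := fun x y => by
        ext i
        exact inner_add_right (f i) x y
      map_smul' := fun c x => by
        ext i
        exact inner_smul_right (f i) x c }
    (by
      have hf' := hf
      obtain ⟨A, B, -, hB, h⟩ := hf'
      refine ⟨√B, fun x => ?_⟩
      refine abs_le_of_sq_le_sq' ?_ (by positivity) |>.2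
      rw [mul_pow, Real.sq_sqrt hB.le]
      exact (hf.norm_sq x).trans_le (h x).2.2)

variable [CompleteSpace H]

/-- The frame operator `S = T* T`, that is, `S x = ∑ i, ⟨x, f i⟩ f i`. -/
def frameOperator (f : I → H) (hf : IsFrame f) : H →L[ℂ] H :=
  (ContinuousLinearMap.adjoint (analysis f hf)).comp (analysis f hf)

/-- The frame operator is invertible, so that `S⁻¹` and `S^{-1/2}` below are genuine. -/
theorem isUnit_frameOperator (f : I → H) (hf : IsFrame f) : IsUnit (frameOperator f hf) := by
  have hf' := hf
  obtain ⟨A, B, hA, -, h⟩ := hf'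
  refine ContinuousLinearMap.isUnit_of_forall_le_norm_inner_map _ (c := ⟨A, hA.le⟩) hA ?_
  intro x
  have h1 : inner ℂ (frameOperator f hf x) x = ((‖analysis f hf x‖ ^ 2 : ℝ) : ℂ) := by
    rw [frameOperator, ContinuousLinearMap.comp_apply, ContinuousLinearMap.adjoint_inner_left,
      inner_self_eq_norm_sq_to_K]
    norm_cast
  rw [h1, Complex.norm_real, Real.norm_of_nonneg (by positivity)]
  have h2 : ‖analysis f hf x‖ ^ 2 = ∑' i, ‖inner ℂ (f i) x‖ ^ 2 := hf.norm_sq x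
  rw [h2]
  calc ‖x‖ ^ 2 * A = A * ‖x‖ ^ 2 := mul_comm _ _
    _ ≤ _ := (h x).2.1

/-- The canonical dual frame `(S⁻¹ f i)_i`. -/
def canonicalDual (f : I → H) (hf : IsFrame f) : I → H :=
  fun i => Ring.inverse (frameOperator f hf) (f i)

/-- The canonical Parseval frame `(S^{-1/2} f i)_i`; the power is the one given by the
continuous functional calculus. -/
def canonicalParseval (f : I → H) (hf : IsFrame f) : I → H :=
  fun i => (frameOperator f hf ^ (-(1 / 2) : ℝ) : H →L[ℂ] H) (f i)

end Frames

/-! ### Localization -/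

section Localization

variable {H : Type*} [NormedAddCommGroup H] [InnerProductSpace ℂ H] {I : Type*}
  {G : Type*} [AddCommGroup G]

/-- `(f, a)` is `ℓᵖ`-self-localized: there is `r ∈ ℓᵖ(G)` with
`|⟨f i, f j⟩| ≤ r (a i - a j)` for all `i, j`. -/
def IsSelfLocalized (p : ℝ≥0∞) (f : I → H) (a : I → G) : Prop :=
  ∃ r : lp (fun _ : G => ℝ) p, ∀ i j, ‖inner ℂ (f i) (f j)‖ ≤ r (a i - a j)

/-- `(f, a)` is `ℓᵖ`-localized with respect to its canonical dual frame `f'`: there is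
`r ∈ ℓᵖ(G)` with `|⟨f i, f' j⟩| ≤ r (a i - a j)` for all `i, j`. -/
def IsDualLocalized [CompleteSpace H] (p : ℝ≥0∞) (f : I → H) (hf : IsFrame f) (a : I → G) :
    Prop :=
  ∃ r : lp (fun _ : G => ℝ) p, ∀ i j, ‖inner ℂ (f i) (canonicalDual f hf j)‖ ≤ r (a i - a j)

end Localization

end LocalizedFrames

end

/-! Let `T` be the analysis operator, so that `S = T* T`, and let `V = T T*` be the Gram matrix
`⟨f i, f j⟩`. For `z ≠ 0` outside the spectrum of `S` one has
`z (z - V)⁻¹ = 1 + T (z - S)⁻¹ T*`. Hence `z ↦ ⟨f i, (z - S)⁻¹ f j⟩`, which is holomorphic near `0`,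
is controlled on a small circle `|z| = ε` by the entries of `(z - V)⁻¹`, although `V` itself need
not be invertible. The maximum principle then bounds `⟨f i, S⁻¹ f j⟩`, which gives (a) and (c), and
Cauchy's estimate for the derivative at `0` bounds `⟨f i, S⁻² f j⟩`, which gives (b).

What is needed on the circle is a form of Wiener's lemma that is uniform in `z`. Split
`V = ∑ g, D g` according to the diagonals `a i - a j = g`; since the fibres of `a` are bounded,
Schur's test makes `∑ g, ‖D g‖` finite. For a character `χ` of `G`, conjugation by the diagonal
unitary with entries `χ (a i)` takes `V` to `∑ g, χ g • D g`, so every value of the Fourier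
transform of `z δ₀ - D` is invertible. The Bochner–Phillips theorem over the algebra of continuous
functions from the circle to `B(ℓ²(I))` provides an `ℓ¹` inverse for all `z` at once. Its proof is
Gelfand theory one-sidedly: modulo a maximal left ideal the translations, being central, act as
scalars, hence as a character. -/

noncomputable section

namespace LocalizedFrames

/-! ### The Bochner–Phillips theorem -/

section Center

variable {𝔄 : Type*} [NormedRing 𝔄] [NormedAlgebra ℂ 𝔄] [CompleteSpace 𝔄]

/- Multiplication by `z` is an endomorphism of the simple module `𝔄 ⧸ J`: by Schur's lemma it is
equal to each of the scalars in its spectrum. -/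
theorem exists_sub_algebraMap_mem_of_mem_center (J : Ideal 𝔄) [hJ : J.IsMaximal] {z : 𝔄}
    (hz : z ∈ Subalgebra.center ℂ 𝔄) : ∃ c : ℂ, z - algebraMap ℂ 𝔄 c ∈ J := by
  have : IsClosed (J : Set 𝔄) := Ideal.IsMaximal.isClosed
  have : IsSimpleModule 𝔄 (𝔄 ⧸ J) := isSimpleModule_iff_isCoatom.2 hJ.out
  have : Nontrivial (𝔄 ⧸ J) := IsSimpleModule.nontrivial 𝔄 _
  have hzJ : J ≤ Submodule.comap (LinearMap.toSpanSingleton 𝔄 𝔄 z) J := fun x hx => by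
    simpa [Subalgebra.mem_center_iff.1 hz x] using J.mul_mem_left z hx
  let Φ : Module.End 𝔄 (𝔄 ⧸ J) := J.mapQ J (LinearMap.toSpanSingleton 𝔄 𝔄 z) hzJ
  let Z : (𝔄 ⧸ J) →L[ℂ] (𝔄 ⧸ J) := ⟨Φ.restrictScalars ℂ, isQuotientMap_quot_mk.continuous_iff.2
    (continuous_quot_mk.comp (continuous_mul_const z))⟩
  obtain ⟨c, hc⟩ := spectrum.nonempty Z
  refine ⟨c, ?_⟩
  obtain hbij | hzero := (Φ - algebraMap ℂ (Module.End 𝔄 (𝔄 ⧸ J)) c).bijective_or_eq_zero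
  · rw [spectrum.mem_iff, ← IsUnit.neg_iff, neg_sub] at hc
    exact absurd (ContinuousLinearMap.isUnit_iff_bijective.2 hbij) hc
  · have hΦ : Φ (J.mkQ 1) = J.mkQ (algebraMap ℂ 𝔄 c) := by
      rw [sub_eq_zero.1 hzero, Module.algebraMap_end_apply, ← mul_one (algebraMap ℂ 𝔄 c),
        ← Algebra.smul_def]
      rfl
    rw [← Submodule.Quotient.eq, ← Submodule.mkQ_apply, ← Submodule.mkQ_apply, ← hΦ]
    simp [Φ]

theorem exists_algHom_center_sub_mem (J : Ideal 𝔄) [hJ : J.IsMaximal] :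
    ∃ φ : Subalgebra.center ℂ 𝔄 →ₐ[ℂ] ℂ, ∀ z : Subalgebra.center ℂ 𝔄,
      (z : 𝔄) - algebraMap ℂ 𝔄 (φ z) ∈ J := by
  choose φ hφ using fun z : Subalgebra.center ℂ 𝔄 => exists_sub_algebraMap_mem_of_mem_center J z.2
  have huniq {z : Subalgebra.center ℂ 𝔄} {c : ℂ} (h : (z : 𝔄) - algebraMap ℂ 𝔄 c ∈ J) :
      φ z = c := by
    by_contra hne
    have hmem : algebraMap ℂ 𝔄 (φ z - c) ∈ J := by
      simpa using J.sub_mem h (hφ z)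
    exact hJ.ne_top (J.eq_top_of_isUnit_mem hmem ((sub_ne_zero.2 hne).isUnit.map _))
  have hadd (z w : Subalgebra.center ℂ 𝔄) : φ (z + w) = φ z + φ w := huniq <| by
    simpa [add_sub_add_comm] using J.add_mem (hφ z) (hφ w)
  have hmul (z w : Subalgebra.center ℂ 𝔄) : φ (z * w) = φ z * φ w := huniq <| by
    have h := J.add_mem (J.mul_mem_left z (hφ w)) (J.mul_mem_left (algebraMap ℂ 𝔄 (φ w)) (hφ z))
    rwa [mul_sub, mul_sub, ← Algebra.commutes, ← map_mul, mul_comm (φ w),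
      sub_add_sub_cancel] at h
  have halg (c : ℂ) : φ (algebraMap ℂ _ c) = c := huniq <| by simp
  exact ⟨{ toFun := φ, map_one' := by simpa using halg 1, map_mul' := hmul,
           map_zero' := by simpa using halg 0, map_add' := hadd, commutes' := halg }, hφ⟩

theorem norm_addChar_eq_one {G : Type*} [AddCommGroup G] {χ : AddChar G ℂ}
    (h : ∀ g, ‖χ g‖ ≤ 1) (g : G) : ‖χ g‖ = 1 := by
  refine (h g).antisymm ?_
  have hg : ‖χ g‖ * ‖χ (-g)‖ = 1 := by
    rw [← norm_mul, ← AddChar.map_add_eq_mul, add_neg_cancel, AddChar.map_zero_eq_one, norm_one]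
  calc 1 = ‖χ g‖ * ‖χ (-g)‖ := hg.symm
    _ ≤ ‖χ g‖ := mul_le_of_le_one_right (norm_nonneg _) (h _)

theorem exists_mul_tsum_eq_one {G : Type*} [AddCommGroup G]
    (u : AddChar G (Subalgebra.center ℂ 𝔄)) (hu : ∀ g, ‖u g‖ ≤ 1) {b : G → 𝔄}
    (hb : Summable fun g => ‖b g‖)
    (h : ∀ χ : AddChar G ℂ, (∀ g, ‖χ g‖ = 1) → ∃ y, y * ∑' g, χ g • b g = 1) :
    ∃ y, y * ∑' g, u g * b g = 1 := by
  by_contra! hT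
  obtain ⟨J, hJ, hle⟩ := Ideal.exists_le_maximal (Ideal.span {∑' g, u g * b g}) fun htop => by
    obtain ⟨y, hy⟩ := Ideal.mem_span_singleton'.1 ((Ideal.eq_top_iff_one _).1 htop)
    exact hT y hy
  obtain ⟨φ, hφ⟩ := exists_algHom_center_sub_mem J
  have : CompleteSpace (Subalgebra.center ℂ 𝔄) := by
    have : IsClosed (Set.center 𝔄) := by
      rw [← Set.centralizer_univ]; exact Set.isClosed_centralizer _
    exact this.completeSpace_coe
  let χ : AddChar G ℂ := φ.toMonoidHom.compAddChar u
  have hχ : ∀ g, ‖χ g‖ = 1 := norm_addChar_eq_one fun g =>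
    (AlgHom.norm_apply_le_self_mul_norm_one φ (u g)).trans
      (mul_le_one₀ (hu g) (norm_nonneg _) (by simpa using hu 0))
  obtain ⟨y, hy⟩ := h χ hχ
  have hu_sum : Summable fun g => u g * b g := .of_norm_bounded hb fun g =>
    (norm_mul_le _ _).trans (mul_le_of_le_one_left (norm_nonneg _) (hu g))
  have hχ_sum : Summable fun g => χ g • b g := .of_norm_bounded hb fun g => by
    rw [norm_smul, hχ, one_mul]
  have hdiff : ∑' g, u g * b g - ∑' g, χ g • b g ∈ J := by
    rw [← hu_sum.tsum_sub hχ_sum]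
    refine tsum_mem (Ideal.IsMaximal.isClosed (I := J)) fun g => ?_
    rw [← Subalgebra.mem_center_iff.1 (u g).2, Algebra.smul_def, Algebra.commutes, ← mul_sub]
    exact J.mul_mem_left _ (hφ (u g))
  have hmem : ∑' g, χ g • b g ∈ J := by
    simpa using J.sub_mem (hle (Ideal.mem_span_singleton_self _)) hdiff
  exact hJ.ne_top ((Ideal.eq_top_iff_one J).2 (hy ▸ J.mul_mem_left y hmem))

theorem exists_mem_centralizer_mul_tsum_eq_one {G : Type*} [AddCommGroup G] {s : Set 𝔄}
    (u : AddChar G 𝔄) (hu : ∀ g, ‖u g‖ ≤ 1) (hus : ∀ g, u g ∈ Subalgebra.centralizer ℂ s)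
    (hsu : Set.range u ⊆ s) {b : G → 𝔄} (hb : Summable fun g => ‖b g‖)
    (hbs : ∀ g, b g ∈ Subalgebra.centralizer ℂ s)
    (h : ∀ χ : AddChar G ℂ, (∀ g, ‖χ g‖ = 1) →
      ∃ y ∈ Subalgebra.centralizer ℂ s, y * ∑' g, χ g • b g = 1) :
    ∃ y ∈ Subalgebra.centralizer ℂ s, y * ∑' g, u g * b g = 1 := by
  let C := Subalgebra.centralizer ℂ s
  have hC : IsClosed (C : Set 𝔄) := Set.isClosed_centralizer s
  have : CompleteSpace C := hC.completeSpace_coe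
  have coe_tsum {f : G → C} (hf : Summable f) : ((∑' g, f g : C) : 𝔄) = ∑' g, (f g : 𝔄) :=
    (hf.hasSum.map C.val.toLinearMap.toAddMonoidHom continuous_subtype_val).tsum_eq.symm
  let b' (g : G) : C := ⟨b g, hbs g⟩
  have hb' : Summable fun g => ‖b' g‖ := hb
  let u' : AddChar G (Subalgebra.center ℂ C) :=
    { toFun := fun g => ⟨⟨u g, hus g⟩, Subalgebra.mem_center_iff.2 fun x =>
        Subtype.ext (x.2 (u g) (hsu ⟨g, rfl⟩)).symm⟩
      map_zero_eq_one' := Subtype.ext <| Subtype.ext u.map_zero_eq_one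
      map_add_eq_mul' := fun g h => Subtype.ext <| Subtype.ext <| u.map_add_eq_mul g h }
  obtain ⟨y, hy⟩ := exists_mul_tsum_eq_one u' hu hb' fun χ hχ => by
    obtain ⟨y, hyC, hy⟩ := h χ hχ
    refine ⟨⟨y, hyC⟩, Subtype.ext ?_⟩
    have hsum : Summable fun g => χ g • b' g := .of_norm_bounded hb' fun g => by
      rw [norm_smul, hχ, one_mul]
    rw [MulMemClass.coe_mul, coe_tsum hsum]
    exact hy
  have hsum : Summable fun g => (u' g : C) * b' g := .of_norm_bounded hb' fun g =>
    (norm_mul_le _ _).trans (mul_le_of_le_one_left (norm_nonneg _) (hu g))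
  refine ⟨y, y.2, ?_⟩
  have := congrArg Subtype.val hy
  rwa [MulMemClass.coe_mul, coe_tsum hsum] at this

end Center

section Convolution

/-- The space `ℓ¹(ι, E)`. -/
abbrev L1 (ι E : Type*) [NormedAddCommGroup E] : Type _ := lp (fun _ : ι => E) 1

variable {ι E : Type*} [NormedAddCommGroup E]

theorem memℓp_one_iff {x : ι → E} : Memℓp x 1 ↔ Summable fun i => ‖x i‖ := by
  simpa using memℓp_gen_iff (E := fun _ : ι => E) (p := 1) (f := x) (by simp)

theorem summable_norm_lp_one (x : L1 ι E) : Summable fun i => ‖x i‖ :=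
  memℓp_one_iff.1 (lp.memℓp x)

theorem norm_lp_one (x : L1 ι E) : ‖x‖ = ∑' i, ‖x i‖ := by
  simpa using lp.norm_eq_tsum_rpow (p := 1) (by simp) x

variable {G : Type*} [AddCommGroup G]

section Translation

variable [NormedSpace ℂ E]

/-- Translation by `g` on `ℓ¹(G, E)`. -/
def lpTranslate (g : G) : L1 G E →L[ℂ] L1 G E :=
  LinearMap.mkContinuous
    { toFun := fun x => ⟨fun m => x (m - g), memℓp_one_iff.2
        ((summable_norm_lp_one x).comp_injective (Equiv.subRight g).injective)⟩
      map_add' := fun _ _ => rfl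
      map_smul' := fun _ _ => rfl } 1 fun x => by
        rw [one_mul, norm_lp_one, norm_lp_one]
        exact ((Equiv.subRight g).tsum_eq fun m => ‖x m‖).le

theorem lpTranslate_apply (g : G) (x : L1 G E) (m : G) :
    lpTranslate g x m = x (m - g) := rfl

theorem norm_lpTranslate_le (g : G) : ‖(lpTranslate g : L1 G E →L[ℂ] _)‖ ≤ 1 :=
  LinearMap.mkContinuous_norm_le _ zero_le_one _

theorem lpTranslate_zero : (lpTranslate (0 : G) : L1 G E →L[ℂ] _) = 1 := by
  ext x m
  simp [lpTranslate_apply]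

theorem lpTranslate_add (g h : G) :
    (lpTranslate (g + h) : L1 G E →L[ℂ] _) = lpTranslate g * lpTranslate h := by
  ext x m
  simp [lpTranslate_apply, sub_add_eq_sub_sub]

end Translation

open MulOpposite ContinuousLinearMap

variable {𝔅 : Type*} [NormedRing 𝔅] [NormedAlgebra ℂ 𝔅] [CompleteSpace 𝔅]

section Bimodule

variable {X : Type*} [NormedAddCommGroup X] [NormedSpace ℂ X] [CompleteSpace X]
  [Module 𝔅 X] [IsBoundedSMul 𝔅 X] [IsScalarTower ℂ 𝔅 X]
  [Module 𝔅ᵐᵒᵖ X] [IsBoundedSMul 𝔅ᵐᵒᵖ X] [IsScalarTower ℂ 𝔅ᵐᵒᵖ X] [SMulCommClass 𝔅 𝔅ᵐᵒᵖ X]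

/- The convolution is written with right multiplications, which commute with the left ones, so that
its inverse `L` can be chosen to be left `𝔅`-linear. -/
theorem exists_commuting_leftInverse (τ : AddChar G (X →L[ℂ] X)) (hτ : ∀ g, ‖τ g‖ ≤ 1)
    (hl : ∀ g (c : 𝔅) x, τ g (c • x) = c • τ g x)
    (hr : ∀ g (c : 𝔅ᵐᵒᵖ) x, τ g (c • x) = c • τ g x) {b : G → 𝔅} (hb : Summable fun g => ‖b g‖)
    (h : ∀ χ : AddChar G ℂ, (∀ g, ‖χ g‖ = 1) → ∃ y, (∑' g, χ g • b g) * y = 1) :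
    ∃ L : X →L[ℂ] X, (∀ g x, L (τ g x) = τ g (L x)) ∧ (∀ (c : 𝔅) x, L (c • x) = c • L x) ∧
      ∀ x, HasSum (fun g => L (τ g (op (b g) • x))) x := by
  let ρ : 𝔅ᵐᵒᵖ →L[ℂ] X →L[ℂ] X := ContinuousLinearMap.lsmul ℂ 𝔅ᵐᵒᵖ
  let s := Set.range τ ∪ Set.range (ContinuousLinearMap.lsmul ℂ 𝔅 : 𝔅 →L[ℂ] X →L[ℂ] X)
  have hτs (g : G) : τ g ∈ Subalgebra.centralizer ℂ s := by
    rintro _ (⟨k, rfl⟩ | ⟨c, rfl⟩)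
    · rw [← τ.map_add_eq_mul, add_comm, τ.map_add_eq_mul]
    · exact ContinuousLinearMap.ext fun x => (hl g c x).symm
  have hρs (c : 𝔅ᵐᵒᵖ) : ρ c ∈ Subalgebra.centralizer ℂ s := by
    rintro _ (⟨k, rfl⟩ | ⟨d, rfl⟩)
    · exact ContinuousLinearMap.ext fun x => hr k c x
    · exact ContinuousLinearMap.ext fun x => smul_comm d c x
  have hρ_sum : Summable fun g => ‖ρ (op (b g))‖ :=
    .of_nonneg_of_le (fun _ => norm_nonneg _) (fun g => opNorm_lsmul_apply_le (op (b g))) hb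
  obtain ⟨L, hLs, hL⟩ := exists_mem_centralizer_mul_tsum_eq_one τ hτ hτs
    Set.subset_union_left hρ_sum (fun g => hρs _) fun χ hχ => by
      obtain ⟨y, hy⟩ := h χ hχ
      have hsum : Summable fun g => op (χ g • b g) := .of_norm_bounded hb fun g => by
        rw [norm_op, norm_smul, hχ, one_mul]
      refine ⟨ρ (op y), hρs _, ContinuousLinearMap.ext fun x => ?_⟩
      calc (ρ (op y) * ∑' g, χ g • ρ (op (b g))) x
          = op y • op (∑' g, χ g • b g) • x := by
            simp only [← map_smul, ← op_smul, ← ρ.map_tsum hsum, tsum_op]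
            rfl
        _ = x := by rw [smul_smul, ← op_mul, hy, op_one, one_smul]
  have hτρ_sum : Summable fun g => τ g * ρ (op (b g)) := .of_norm_bounded hρ_sum fun g =>
    (norm_mul_le _ _).trans (mul_le_of_le_one_left (norm_nonneg _) (hτ g))
  refine ⟨L, fun g x => (DFunLike.congr_fun (hLs (τ g) (.inl ⟨g, rfl⟩)) x).symm,
    fun c x => (DFunLike.congr_fun (hLs _ (.inr ⟨c, rfl⟩)) x).symm, fun x => ?_⟩
  have hsum := (hτρ_sum.hasSum.mapL (ContinuousLinearMap.apply ℂ X x)).mapL L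
  convert! hsum using 1
  exact (DFunLike.congr_fun hL x).symm

theorem exists_hasSum_smul_eq (τ : AddChar G (X →L[ℂ] X)) (hτ : ∀ g, ‖τ g‖ ≤ 1)
    (hl : ∀ g (c : 𝔅) x, τ g (c • x) = c • τ g x)
    (hr : ∀ g (c : 𝔅ᵐᵒᵖ) x, τ g (c • x) = c • τ g x)
    {δ : X} (hδ : ∀ c : 𝔅, op c • δ = c • δ) {b : G → 𝔅} (hb : Summable fun g => ‖b g‖)
    (h : ∀ χ : AddChar G ℂ, (∀ g, ‖χ g‖ = 1) → ∃ y, (∑' g, χ g • b g) * y = 1) :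
    ∃ F : X, HasSum (fun g => b g • τ g F) δ := by
  obtain ⟨L, hLτ, hLl, hL⟩ := exists_commuting_leftInverse τ hτ hl hr hb h
  refine ⟨L δ, ?_⟩
  convert! hL δ using 2 with g
  rw [hδ, hl, hLl, hLτ]

end Bimodule

/-- **Bochner–Phillips theorem**: `b` has a right inverse for convolution as soon as every value of
its Fourier transform has a right inverse. -/
theorem exists_hasSum_mul_eq_single [DecidableEq G] {b : G → 𝔅}
    (hb : Summable fun g => ‖b g‖)
    (h : ∀ χ : AddChar G ℂ, (∀ g, ‖χ g‖ = 1) → ∃ y, (∑' g, χ g • b g) * y = 1) :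
    ∃ F : L1 G 𝔅, ∀ m, HasSum (fun g => b g * F (m - g)) ((Pi.single 0 1 : G → 𝔅) m) := by
  obtain ⟨F, hF⟩ := exists_hasSum_smul_eq (X := L1 G 𝔅) (δ := lp.single 1 0 1)
    ⟨lpTranslate, lpTranslate_zero, lpTranslate_add⟩ norm_lpTranslate_le
    (fun _ _ _ => rfl) (fun _ _ _ => rfl) (fun c => by
      ext m
      obtain rfl | hm := eq_or_ne m 0
      · simp
      · simp [hm]) hb h
  exact ⟨F, fun m => hF.mapL (lp.evalCLM ℂ (fun _ : G => 𝔅) 1 m)⟩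

end Convolution

/-! ### Matrices of operators on `ℓ²(I)` -/

section SequenceSpace

/-- The Hilbert space `ℓ²(I)`. -/
abbrev L2 (I : Type*) : Type _ := lp (fun _ : I => ℂ) 2

variable {I J : Type*}

theorem sum_norm_sq_le (x : L2 J) (t : Finset J) : ∑ j ∈ t, ‖x j‖ ^ 2 ≤ ‖x‖ ^ 2 := by
  simpa using lp.sum_rpow_le_norm_rpow (p := 2) (by norm_num) x t

theorem norm_le_of_forall_sum_norm_sq_le {x : L2 I} {C : ℝ} (hC : 0 ≤ C)
    (h : ∀ s : Finset I, ∑ i ∈ s, ‖x i‖ ^ 2 ≤ C ^ 2) : ‖x‖ ≤ C :=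
  lp.norm_le_of_forall_sum_le (by norm_num) hC fun s => by simpa using h s

section SchurTest

variable {m : I → J → ℂ} {M : ℝ}

theorem sum_norm_sum_mul_sq_le (hrow : ∀ i (t : Finset J), ∑ j ∈ t, ‖m i j‖ ≤ M)
    (hcol : ∀ j (s : Finset I), ∑ i ∈ s, ‖m i j‖ ≤ M) (hM : 0 ≤ M) (x : L2 J)
    (s : Finset I) (t : Finset J) :
    ∑ i ∈ s, ‖∑ j ∈ t, m i j * x j‖ ^ 2 ≤ (M * ‖x‖) ^ 2 := by
  have hi (i : I) : ‖∑ j ∈ t, m i j * x j‖ ^ 2 ≤ M * ∑ j ∈ t, ‖m i j‖ * ‖x j‖ ^ 2 :=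
    calc ‖∑ j ∈ t, m i j * x j‖ ^ 2
        ≤ (∑ j ∈ t, ‖m i j‖ * ‖x j‖) ^ 2 := by
          gcongr
          exact norm_sum_le_of_le _ fun j _ => norm_mul_le _ _
      _ ≤ (∑ j ∈ t, ‖m i j‖) * ∑ j ∈ t, ‖m i j‖ * ‖x j‖ ^ 2 :=
          Finset.sum_sq_le_sum_mul_sum_of_sq_le_mul _ (fun _ _ => by positivity)
            (fun _ _ => by positivity) fun j _ => by rw [mul_pow, sq ‖m i j‖, mul_assoc]
      _ ≤ M * ∑ j ∈ t, ‖m i j‖ * ‖x j‖ ^ 2 := by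
          gcongr
          exact hrow i t
  calc ∑ i ∈ s, ‖∑ j ∈ t, m i j * x j‖ ^ 2
      ≤ ∑ i ∈ s, M * ∑ j ∈ t, ‖m i j‖ * ‖x j‖ ^ 2 := Finset.sum_le_sum fun i _ => hi i
    _ = M * ∑ j ∈ t, (∑ i ∈ s, ‖m i j‖) * ‖x j‖ ^ 2 := by
        rw [← Finset.mul_sum, Finset.sum_comm]
        simp only [Finset.sum_mul]
    _ ≤ M * ∑ j ∈ t, M * ‖x j‖ ^ 2 := by
        gcongr with j
        exact hcol j s
    _ = M ^ 2 * ∑ j ∈ t, ‖x j‖ ^ 2 := by rw [← Finset.mul_sum]; ring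
    _ ≤ M ^ 2 * ‖x‖ ^ 2 := by gcongr; exact sum_norm_sq_le x t
    _ = (M * ‖x‖) ^ 2 := by ring

/-- **Schur test**. -/
theorem exists_norm_le_hasSum_mul (hrow : ∀ i (t : Finset J), ∑ j ∈ t, ‖m i j‖ ≤ M)
    (hcol : ∀ j (s : Finset I), ∑ i ∈ s, ‖m i j‖ ≤ M) (hM : 0 ≤ M) :
    ∃ D : L2 J →L[ℂ] L2 I, ‖D‖ ≤ M ∧ ∀ x i, HasSum (fun j => m i j * x j) (D x i) := by
  have hsum (x : L2 J) (i : I) : Summable fun j => m i j * x j := by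
    refine .of_norm_bounded ((summable_of_sum_le (fun _ => norm_nonneg _) (hrow i)).mul_right ‖x‖)
      fun j => (norm_mul_le _ _).trans ?_
    gcongr
    exact lp.norm_apply_le_norm (by norm_num) x j
  have hbound (x : L2 J) (s : Finset I) : ∑ i ∈ s, ‖∑' j, m i j * x j‖ ^ 2 ≤ (M * ‖x‖) ^ 2 :=
    le_of_tendsto' (tendsto_finsetSum s fun i _ => (hsum x i).hasSum.norm.pow 2)
      (sum_norm_sum_mul_sq_le hrow hcol hM x s)
  refine ⟨LinearMap.mkContinuous
    { toFun := fun x => ⟨fun i => ∑' j, m i j * x j,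
        memℓp_gen' (C := (M * ‖x‖) ^ 2) fun s => by simpa using hbound x s⟩
      map_add' := fun x y => lp.ext <| funext fun i => by
        exact (tsum_congr fun j => mul_add _ _ _).trans ((hsum x i).tsum_add (hsum y i))
      map_smul' := fun c x => lp.ext <| funext fun i => by
        simpa [mul_left_comm] using tsum_mul_left } M fun x =>
        norm_le_of_forall_sum_norm_sq_le (by positivity) (hbound x),
    LinearMap.mkContinuous_norm_le _ hM _, fun x i => (hsum x i).hasSum⟩

end SchurTest

section Entry

variable [DecidableEq I]

/-- The `(i, j)` entry `⟨e i, D (e j)⟩` of the matrix of an operator `D` on `ℓ²(I)`. -/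
def entry (i j : I) : (L2 I →L[ℂ] L2 I) →L[ℂ] ℂ :=
  (lp.evalCLM ℂ (fun _ : I => ℂ) 2 i).comp (ContinuousLinearMap.apply ℂ (L2 I) (lp.single 2 j 1))

theorem entry_apply (i j : I) (D : L2 I →L[ℂ] L2 I) :
    entry i j D = D (lp.single 2 j 1) i := rfl

theorem entry_one (i j : I) : entry i j 1 = if i = j then 1 else 0 := by
  simp [entry_apply, lp.single_apply, Pi.single_apply]

theorem hasSum_entry_mul (D : L2 I →L[ℂ] L2 I) (x : L2 I) (i : I) :
    HasSum (fun j => entry i j D * x j) (D x i) := by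
  have h := ((lp.hasSum_single (by norm_num) x).mapL D).mapL (lp.evalCLM ℂ (fun _ : I => ℂ) 2 i)
  convert! h using 2 with j
  have : lp.single 2 j (x j) = x j • lp.single (E := fun _ : I => ℂ) 2 j 1 := by
    rw [← lp.single_smul, smul_eq_mul, mul_one]
  rw [this, map_smul, map_smul, smul_eq_mul, mul_comm]
  rfl

theorem ext_entry {D E : L2 I →L[ℂ] L2 I} (h : ∀ i j, entry i j D = entry i j E) : D = E := by
  ext x i
  exact (hasSum_entry_mul D x i).unique (by simpa only [h] using hasSum_entry_mul E x i)

theorem norm_entry_le (D : L2 I →L[ℂ] L2 I) (i j : I) : ‖entry i j D‖ ≤ ‖D‖ := by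
  rw [entry_apply]
  refine (lp.norm_apply_le_norm (by norm_num) _ i).trans ((D.le_opNorm _).trans_eq ?_)
  rw [lp.norm_single (by norm_num), norm_one, mul_one]

end Entry

end SequenceSpace

section Homogeneous

variable {I G : Type*} {a : I → G} {K : ℕ}

theorem sum_comp_le_of_encard_preimage_le (hK : ∀ g, (a ⁻¹' {g}).encard ≤ K) {φ : G → ℝ}
    (hφ : 0 ≤ φ) (hs : Summable φ) (s : Finset I) :
    ∑ i ∈ s, φ (a i) ≤ K * ∑' g, φ g := by
  classical
  have hcard (g : G) : (s.filter (a · = g)).card ≤ K := by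
    rw [← Nat.cast_le (α := ℕ∞), ← Set.encard_coe_eq_coe_finsetCard]
    exact (Set.encard_le_encard fun i hi => by simp_all).trans (hK g)
  calc ∑ i ∈ s, φ (a i) = ∑ g ∈ s.image a, (s.filter (a · = g)).card • φ g := Finset.sum_comp φ a
    _ ≤ ∑ g ∈ s.image a, K • φ g :=
        Finset.sum_le_sum fun g _ => nsmul_le_nsmul_left (hφ g) (hcard g)
    _ = K * ∑ g ∈ s.image a, φ g := by rw [← Finset.smul_sum, nsmul_eq_mul]
    _ ≤ K * ∑' g, φ g := by
        gcongr
        exact hs.sum_le_tsum _ fun g _ => hφ g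

variable [AddCommGroup G] [DecidableEq I]

theorem exists_norm_le_entry_eq (hK : ∀ g, (a ⁻¹' {g}).encard ≤ K) {φ : G → ℝ}
    (hφ : 0 ≤ φ) (hs : Summable φ) {m : I → I → ℂ}
    (hm : ∀ i j, ‖m i j‖ ≤ φ (a i - a j)) :
    ∃ D : L2 I →L[ℂ] L2 I, ‖D‖ ≤ K * ∑' g, φ g ∧ ∀ i j, entry i j D = m i j := by
  have hrow (i : I) (t : Finset I) : ∑ j ∈ t, ‖m i j‖ ≤ K * ∑' g, φ g := by
    rw [← (Equiv.subLeft (a i)).tsum_eq φ]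
    exact (Finset.sum_le_sum fun j _ => hm i j).trans <|
      sum_comp_le_of_encard_preimage_le hK (fun g => hφ (a i - g))
        ((Equiv.subLeft (a i)).summable_iff.2 hs) t
  have hcol (j : I) (s : Finset I) : ∑ i ∈ s, ‖m i j‖ ≤ K * ∑' g, φ g := by
    rw [← (Equiv.subRight (a j)).tsum_eq φ]
    exact (Finset.sum_le_sum fun i _ => hm i j).trans <|
      sum_comp_le_of_encard_preimage_le hK (fun g => hφ (g - a j))
        ((Equiv.subRight (a j)).summable_iff.2 hs) s
  obtain ⟨D, hD, hDm⟩ := exists_norm_le_hasSum_mul hrow hcol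
    (mul_nonneg K.cast_nonneg (tsum_nonneg hφ))
  refine ⟨D, hD, fun i j => (hDm (lp.single 2 j 1) i).unique ?_⟩
  convert! hasSum_pi_single j (m i j) using 2 with k
  obtain rfl | hk := eq_or_ne k j <;> simp [*]

/-- An operator on `ℓ²(I)` is homogeneous of degree `g` if its matrix is supported on the
diagonal `a i - a j = g`. -/
def IsHomogeneous (a : I → G) (g : G) (D : L2 I →L[ℂ] L2 I) : Prop :=
  ∀ i j, a i - a j ≠ g → entry i j D = 0

theorem IsHomogeneous.apply_eq {g : G} {D : L2 I →L[ℂ] L2 I} (hD : IsHomogeneous a g D)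
    {x y : L2 I} {i : I} (hxy : ∀ k, a k = a i - g → x k = y k) : D x i = D y i := by
  refine (hasSum_entry_mul D x i).unique ?_
  convert! hasSum_entry_mul D y i using 2 with k
  by_cases hk : a k = a i - g
  · rw [hxy k hk]
  · rw [hD i k fun h => hk (by rw [← h, sub_sub_cancel]), zero_mul, zero_mul]

theorem exists_isHomogeneous_tsum_eq (hK : ∀ g, (a ⁻¹' {g}).encard ≤ K)
    {V : L2 I →L[ℂ] L2 I} {r : G → ℝ} (hr : Summable r)
    (hV : ∀ i j, ‖entry i j V‖ ≤ r (a i - a j)) :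
    ∃ D : G → L2 I →L[ℂ] L2 I, (Summable fun g => ‖D g‖) ∧ (∀ g, IsHomogeneous a g (D g)) ∧
      ∑' g, D g = V := by
  classical
  have hcomp (g : G) : ∃ D : L2 I →L[ℂ] L2 I, ‖D‖ ≤ K * |r g| ∧
      ∀ i j, entry i j D = if a i - a j = g then entry i j V else 0 := by
    obtain ⟨D, hD, hentry⟩ := exists_norm_le_entry_eq hK (φ := Pi.single g |r g|)
      (m := fun i j => if a i - a j = g then entry i j V else 0)
      (Pi.single_nonneg.2 (abs_nonneg _)) (hasSum_pi_single g _).summable fun i j => by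
        split_ifs with h
        · rw [h, Pi.single_eq_same, ← h]
          exact (hV i j).trans (le_abs_self _)
        · rw [norm_zero, Pi.single_eq_of_ne h]
    exact ⟨D, hD.trans_eq (by rw [tsum_pi_single]), hentry⟩
  choose D hD hentry using hcomp
  have hDs : Summable fun g => ‖D g‖ :=
    .of_nonneg_of_le (fun _ => norm_nonneg _) hD (hr.abs.mul_left _)
  refine ⟨D, hDs, fun g i j h => (hentry g i j).trans (if_neg h), ext_entry fun i j => ?_⟩
  have h := hDs.of_norm.hasSum.mapL (entry i j)
  simp only [hentry] at h
  exact h.unique (by simpa only [eq_comm] using hasSum_ite_eq (a i - a j) (entry i j V))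

theorem exists_unit_conj_eq_smul {χ : AddChar G ℂ} (hχ : ∀ g, ‖χ g‖ = 1) :
    ∃ u : (L2 I →L[ℂ] L2 I)ˣ, ∀ g D, IsHomogeneous a g D →
      χ g • D = (u * D * ↑u⁻¹ : L2 I →L[ℂ] L2 I) := by
  let U (c : I → ℂ) (hc : ∀ i, ‖c i‖ ≤ 1) : L2 I →L[ℂ] L2 I :=
    lp.mapCLM 2 (fun i => ContinuousLinearMap.lsmul ℂ ℂ (c i)) zero_le_one fun i =>
      (ContinuousLinearMap.opNorm_lsmul_apply_le _).trans (hc i)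
  have hU (c : I → ℂ) (hc) (x : L2 I) (i : I) : U c hc x i = c i * x i := rfl
  have hinv (g : G) : χ g * χ (-g) = 1 := by
    rw [← AddChar.map_add_eq_mul, add_neg_cancel, AddChar.map_zero_eq_one]
  have hinv' (g : G) : χ (-g) * χ g = 1 := by rw [mul_comm, hinv]
  let u : (L2 I →L[ℂ] L2 I)ˣ :=
    { val := U (fun i => χ (a i)) fun i => (hχ _).le
      inv := U (fun i => χ (-a i)) fun i => (hχ _).le
      val_inv := by ext x i; simp [hU, ← mul_assoc, hinv]
      inv_val := by ext x i; simp [hU, ← mul_assoc, hinv'] }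
  have hu_single (j : I) : (↑u⁻¹ : L2 I →L[ℂ] L2 I) (lp.single 2 j 1) =
      χ (-a j) • lp.single (E := fun _ : I => ℂ) 2 j 1 := by
    ext i
    change χ (-a i) * _ = χ (-a j) * _
    obtain rfl | hij := eq_or_ne i j <;> simp [*]
  refine ⟨u, fun g D hD => ext_entry fun i j => ?_⟩
  have hconj : entry i j (u * D * ↑u⁻¹ : L2 I →L[ℂ] L2 I) = χ (a i - a j) * entry i j D :=
    calc entry i j (u * D * ↑u⁻¹ : L2 I →L[ℂ] L2 I)
        = χ (a i) * D ((↑u⁻¹ : L2 I →L[ℂ] L2 I) (lp.single 2 j 1)) i := rfl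
      _ = χ (a i - a j) * entry i j D := by
        rw [hu_single, map_smul, sub_eq_add_neg, AddChar.map_add_eq_mul, mul_assoc]
        rfl
  rw [hconj, map_smul, smul_eq_mul]
  obtain hij | hij := eq_or_ne (a i - a j) g
  · rw [hij]
  · rw [hD i j hij, mul_zero, mul_zero]

end Homogeneous

/-! ### Wiener's lemma for the resolvent -/

section Family

variable {G : Type*} [AddCommGroup G] {𝔅 : Type*} [NormedRing 𝔅] [NormedAlgebra ℂ 𝔅]
  [CompleteSpace 𝔅]

theorem exists_summable_norm_hasSum_mul_eq_single [DecidableEq G] {Z : Type*}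
    [TopologicalSpace Z] [CompactSpace Z] {b : G → C(Z, 𝔅)}
    (hb : Summable fun g => ‖b g‖) (hunit : ∀ z, IsUnit (∑' g, b g z))
    (hconj : ∀ χ : AddChar G ℂ, (∀ g, ‖χ g‖ = 1) →
      ∃ u : 𝔅ˣ, ∀ g z, χ g • b g z = u * b g z * ↑u⁻¹) :
    ∃ F : G → C(Z, 𝔅), (Summable fun g => ‖F g‖) ∧
      ∀ z m, HasSum (fun g => b g z * F (m - g) z) ((Pi.single 0 1 : G → 𝔅) m) := by
  have hunit' : IsUnit (∑' g, b g) := (ContinuousMap.isUnit_iff_forall_isUnit _).2 fun z => by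
    rw [← (ContinuousMap.hasSum_apply hb.of_norm.hasSum z).tsum_eq]
    exact hunit z
  obtain ⟨F, hF⟩ := exists_hasSum_mul_eq_single hb fun χ hχ => by
    obtain ⟨u, hu⟩ := hconj χ hχ
    obtain ⟨c, hc⟩ := hunit'.exists_right_inv
    let U : C(Z, 𝔅) := .const Z u
    let U' : C(Z, 𝔅) := .const Z ↑u⁻¹
    have hU : U * U' = 1 := by ext1 z; simp [U, U']
    have hU' : U' * U = 1 := by ext1 z; simp [U, U']
    have hsum : ∑' g, χ g • b g = U * (∑' g, b g) * U' := by
      rw [← hb.of_norm.tsum_mul_left, ← (hb.of_norm.mul_left U).tsum_mul_right]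
      exact tsum_congr fun g => ContinuousMap.ext (hu g)
    refine ⟨U * c * U', ?_⟩
    calc (∑' g, χ g • b g) * (U * c * U')
        = U * ((∑' g, b g) * (U' * U) * c) * U' := by rw [hsum]; noncomm_ring
      _ = 1 := by rw [hU', mul_one, hc, mul_one, hU]
  refine ⟨F, summable_norm_lp_one F, fun z m => ?_⟩
  convert! ContinuousMap.hasSum_apply (hF m) z using 1
  by_cases h : m = 0 <;> simp [h]

theorem exists_summable_norm_le_hasSum_mul_eq_single [DecidableEq G] {D : G → 𝔅}
    (hD : Summable fun g => ‖D g‖)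
    (hconj : ∀ χ : AddChar G ℂ, (∀ g, ‖χ g‖ = 1) → ∃ u : 𝔅ˣ, ∀ g, χ g • D g = u * D g * ↑u⁻¹)
    {C : Set ℂ} (hC : IsCompact C) (hCD : C ⊆ resolventSet ℂ (∑' g, D g)) :
    ∃ s : G → ℝ, Summable s ∧ ∀ z ∈ C, ∃ F : G → 𝔅, (∀ g, ‖F g‖ ≤ s g) ∧
      ∀ m, HasSum (fun g => D g * F (m - g)) (z • F m - (Pi.single 0 1 : G → 𝔅) m) := by
  have : CompactSpace C := isCompact_iff_compactSpace.1 hC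
  let ζ : C(C, 𝔅) := ⟨fun z => algebraMap ℂ 𝔅 z, by fun_prop⟩
  let b (g : G) : C(C, 𝔅) := (Pi.single 0 ζ : G → C(C, 𝔅)) g - .const C (D g)
  have hbz (g : G) (z : C) : b g z = (Pi.single 0 (algebraMap ℂ 𝔅 z) : G → 𝔅) g - D g := by
    obtain rfl | hg := eq_or_ne g 0 <;> simp [b, ζ, *]
  have hζ : Summable fun g => ‖(Pi.single 0 ζ : G → C(C, 𝔅)) g‖ :=
    (hasSum_single 0 fun g hg => by simp [hg]).summable
  have hb : Summable fun g => ‖b g‖ := by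
    refine (hζ.add hD).of_nonneg_of_le (fun _ => norm_nonneg _) fun g => (norm_sub_le _ _).trans ?_
    gcongr
    exact (ContinuousMap.norm_le _ (norm_nonneg _)).2 fun _ => le_rfl
  have hsum (z : C) : ∑' g, b g z = algebraMap ℂ 𝔅 z - ∑' g, D g := by
    simp only [hbz]
    exact ((hasSum_pi_single 0 _).sub hD.of_norm.hasSum).tsum_eq
  obtain ⟨F, hF, hbF⟩ := exists_summable_norm_hasSum_mul_eq_single hb
    (fun z => by rw [hsum]; exact hCD z.2) fun χ hχ => by
      obtain ⟨u, hu⟩ := hconj χ hχ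
      refine ⟨u, fun g z => ?_⟩
      rw [hbz, smul_sub, hu, mul_sub, sub_mul]
      obtain rfl | hg := eq_or_ne g 0
      · rw [Pi.single_eq_same, χ.map_zero_eq_one, one_smul, ← Algebra.commutes,
          Units.mul_inv_cancel_right]
      · simp [hg]
  refine ⟨fun g => ‖F g‖, hF, fun z hz => ⟨fun g => F g ⟨z, hz⟩,
    fun g => (F g).norm_coe_le_norm _, fun m => ?_⟩⟩
  have hz_sum : HasSum (fun g => (Pi.single 0 (algebraMap ℂ 𝔅 z) : G → 𝔅) g * F (m - g) ⟨z, hz⟩)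
      (z • F m ⟨z, hz⟩) := by
    convert! hasSum_pi_single (0 : G) (z • F m ⟨z, hz⟩) using 2 with g
    obtain rfl | hg := eq_or_ne g 0 <;> simp [Algebra.smul_def, *]
  simpa only [hbz, sub_mul, sub_sub_cancel] using hz_sum.sub (hbF ⟨z, hz⟩ m)

end Family

section Wiener

variable {I G : Type*} [DecidableEq I] [AddCommGroup G] {a : I → G} {K : ℕ}

theorem entry_resolvent_tsum [DecidableEq G] (hK : ∀ g, (a ⁻¹' {g}).encard ≤ K)
    {D : G → L2 I →L[ℂ] L2 I} (hD : Summable D) (hhom : ∀ g, IsHomogeneous a g (D g))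
    {z : ℂ} (hz : z ∈ resolventSet ℂ (∑' g, D g)) {F : G → L2 I →L[ℂ] L2 I}
    (hF : Summable fun g => ‖F g‖)
    (hDF : ∀ m, HasSum (fun g => D g * F (m - g))
      (z • F m - (Pi.single 0 1 : G → L2 I →L[ℂ] L2 I) m)) (i j : I) :
    entry i j (resolvent (∑' g, D g) z) = entry i j (F (a i - a j)) := by
  have hy : Memℓp (fun i => entry i j (F (a i - a j))) 1 := memℓp_one_iff.2 <|
    summable_of_sum_le (fun _ => norm_nonneg _) fun s =>
      (Finset.sum_le_sum fun i _ => norm_entry_le _ i j).trans <|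
        sum_comp_le_of_encard_preimage_le hK (φ := fun g => ‖F (g - a j)‖) (fun _ => norm_nonneg _)
          (hF.comp_injective (Equiv.subRight (a j)).injective) s
  let y : L2 I := ⟨fun i => entry i j (F (a i - a j)), hy.of_exponent_ge (by norm_num)⟩
  have hDy (g : G) (k : I) : D g y k = entry k j (D g * F (a k - a j - g)) :=
    (hhom g).apply_eq fun l hl => by
      change entry l j (F (a l - a j)) = _
      rw [hl, sub_right_comm]
      rfl
  have hVy : (∑' g, D g) y = z • y - lp.single 2 j 1 := by
    ext k
    have h₁ := (hD.hasSum.mapL (ContinuousLinearMap.apply ℂ _ y)).mapL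
      (lp.evalCLM ℂ (fun _ : I => ℂ) 2 k)
    have h₂ := (hDF (a k - a j)).mapL (entry k j)
    simp only [← hDy] at h₂
    refine (h₁.unique h₂).trans ?_
    rw [map_sub, map_smul]
    change _ = z • entry k j (F (a k - a j)) - _
    obtain rfl | hkj := eq_or_ne k j
    · simp [entry_one]
    · by_cases h : a k - a j = 0 <;> simp [h, entry_one, hkj]
  have hres : (algebraMap ℂ (L2 I →L[ℂ] L2 I) z - ∑' g, D g) y = lp.single 2 j 1 := by
    rw [sub_apply, hVy]
    exact sub_sub_cancel _ _
  have hinv := DFunLike.congr_fun (Ring.inverse_mul_cancel _ hz) y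
  rw [mul_apply_eq_comp, hres] at hinv
  rw [resolvent, entry_apply, hinv]
  rfl

theorem exists_summable_norm_entry_resolvent_le (hK : ∀ g, (a ⁻¹' {g}).encard ≤ K)
    {V : L2 I →L[ℂ] L2 I} {r : G → ℝ} (hr : Summable r)
    (hV : ∀ i j, ‖entry i j V‖ ≤ r (a i - a j)) {C : Set ℂ} (hC : IsCompact C)
    (hCV : C ⊆ resolventSet ℂ V) :
    ∃ s : G → ℝ, Summable s ∧ ∀ z ∈ C, ∀ i j, ‖entry i j (resolvent V z)‖ ≤ s (a i - a j) := by
  classical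
  obtain ⟨D, hD, hhom, rfl⟩ := exists_isHomogeneous_tsum_eq hK hr hV
  obtain ⟨s, hs, hsF⟩ := exists_summable_norm_le_hasSum_mul_eq_single hD (fun χ hχ => by
    obtain ⟨u, hu⟩ := exists_unit_conj_eq_smul (I := I) (a := a) hχ
    exact ⟨u, fun g => hu g _ (hhom g)⟩) hC hCV
  refine ⟨s, hs, fun z hz i j => ?_⟩
  obtain ⟨F, hFs, hF⟩ := hsF z hz
  rw [entry_resolvent_tsum hK hD.of_norm hhom (hCV hz)
    (.of_nonneg_of_le (fun _ => norm_nonneg _) hFs hs) hF]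
  exact (norm_entry_le _ i j).trans (hFs _)

end Wiener

/-! ### Frames -/

section Resolvent

theorem resolvent_zero_eq_neg_inverse {𝕜 R : Type*} [CommSemiring 𝕜] [Ring R] [Algebra 𝕜 R]
    (x : R) : resolvent x (0 : 𝕜) = -Ring.inverse x := by
  rw [resolvent, map_zero, zero_sub]
  by_cases hx : IsUnit x
  · obtain ⟨u, rfl⟩ := hx
    rw [← Units.val_neg, Ring.inverse_unit, Ring.inverse_unit, inv_neg, Units.val_neg]
  · rw [Ring.inverse_non_unit x hx, Ring.inverse_non_unit (-x) (by rwa [IsUnit.neg_iff]), neg_zero]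

theorem resolvent_comp_swap {𝕜 E F : Type*} [NontriviallyNormedField 𝕜] [NormedAddCommGroup E]
    [NormedSpace 𝕜 E] [NormedAddCommGroup F] [NormedSpace 𝕜 F] (A : E →L[𝕜] F) (B : F →L[𝕜] E)
    {z : 𝕜} (hz : z ≠ 0) (hzBA : z ∈ resolventSet 𝕜 (B.comp A)) :
    z ∈ resolventSet 𝕜 (A.comp B) ∧
      z • resolvent (A.comp B) z = 1 + A.comp ((resolvent (B.comp A) z).comp B) := by
  set R := resolvent (B.comp A) z
  have hR (x : E) : z • R x - B (A (R x)) = x :=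
    DFunLike.congr_fun (Ring.mul_inverse_cancel _ hzBA) x
  have hR' (x : E) : R (z • x - B (A x)) = x :=
    DFunLike.congr_fun (Ring.inverse_mul_cancel _ hzBA) x
  set X := 1 + A.comp (R.comp B)
  have hmul : (algebraMap 𝕜 (F →L[𝕜] F) z - A.comp B) * X = algebraMap 𝕜 (F →L[𝕜] F) z := by
    ext y
    calc z • (y + A (R (B y))) - A (B (y + A (R (B y))))
        = z • y + A (z • R (B y) - B (A (R (B y)))) - A (B y) := by
          simp only [map_add, map_sub, map_smul]; module
      _ = z • y := by rw [hR, add_sub_cancel_right]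
  have hmul' : X * (algebraMap 𝕜 (F →L[𝕜] F) z - A.comp B) = algebraMap 𝕜 (F →L[𝕜] F) z := by
    ext y
    calc z • y - A (B y) + A (R (B (z • y - A (B y))))
        = z • y - A (B y) + A (R (z • B y - B (A (B y)))) := by rw [map_sub B, map_smul B]
      _ = z • y := by rw [hR', sub_add_cancel]
  let u : (F →L[𝕜] F)ˣ := ⟨algebraMap 𝕜 (F →L[𝕜] F) z - A.comp B, z⁻¹ • X,
    by rw [mul_smul_comm, hmul, Algebra.algebraMap_eq_smul_one, inv_smul_smul₀ hz],
    by rw [smul_mul_assoc, hmul', Algebra.algebraMap_eq_smul_one, inv_smul_smul₀ hz]⟩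
  exact ⟨u.isUnit, (congrArg (z • ·) (Ring.inverse_unit u)).trans (smul_inv_smul₀ hz X)⟩

variable {𝔄 E : Type*} [NormedRing 𝔄] [NormedAlgebra ℂ 𝔄] [CompleteSpace 𝔄]
  [NormedAddCommGroup E] [NormedSpace ℂ E] {S : 𝔄} {ε M : ℝ}

theorem norm_map_inverse_le_of_sphere (hε : 0 < ε)
    (hS : Metric.closedBall 0 ε ⊆ resolventSet ℂ S) (φ : 𝔄 →L[ℂ] E)
    (hM : ∀ z ∈ Metric.sphere (0 : ℂ) ε, ‖φ (resolvent S z)‖ ≤ M) :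
    ‖φ (Ring.inverse S)‖ ≤ M ∧ ‖φ (Ring.inverse S * Ring.inverse S)‖ ≤ M / ε := by
  have hderiv (z) (hz : z ∈ Metric.closedBall (0 : ℂ) ε) :
      HasDerivAt (fun z => φ (resolvent S z)) (φ (-resolvent S z ^ 2)) z :=
    φ.hasFDerivAt.comp_hasDerivAt z (spectrum.hasDerivAt_resolvent_const_left (hS hz))
  have hdiff : DiffContOnCl ℂ (fun z : ℂ => φ (resolvent S z)) (Metric.ball 0 ε) :=
    DifferentiableOn.diffContOnCl fun z hz =>
      (hderiv z (Metric.closure_ball_subset_closedBall hz)).differentiableAt.differentiableWithinAt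
  have h₀ := hderiv 0 (Metric.mem_closedBall_self hε.le)
  constructor
  · have := Complex.norm_le_of_forall_mem_frontier_norm_le Metric.isBounded_ball hdiff
      (fun z hz => hM z (by rwa [frontier_ball _ hε.ne'] at hz))
      (subset_closure (Metric.mem_ball_self hε))
    simpa only [resolvent_zero_eq_neg_inverse, map_neg, norm_neg] using this
  · have := Complex.norm_deriv_le_of_forall_mem_sphere_norm_le hε hdiff hM
    rw [h₀.deriv] at this
    simpa only [resolvent_zero_eq_neg_inverse, map_neg, norm_neg, sq, neg_mul_neg] using this

end Resolvent

section FrameOperator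

variable {H : Type*} [NormedAddCommGroup H] [InnerProductSpace ℂ H] [CompleteSpace H] {I : Type*}
  (f : I → H) (hf : IsFrame f)

theorem adjoint_analysis_single [DecidableEq I] (j : I) :
    (analysis f hf).adjoint (lp.single 2 j 1) = f j := by
  refine ext_inner_right ℂ fun x => ?_
  rw [ContinuousLinearMap.adjoint_inner_left, lp.inner_single_left]
  change inner ℂ (1 : ℂ) (inner ℂ (f j) x) = _
  simp

theorem frameOperator_nonneg : 0 ≤ frameOperator f hf :=
  (ContinuousLinearMap.nonneg_iff_isPositive _).2
    (ContinuousLinearMap.isPositive_adjoint_comp_self _)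

theorem isSelfAdjoint_inverse_frameOperator :
    IsSelfAdjoint (Ring.inverse (frameOperator f hf)) :=
  (IsSelfAdjoint.of_nonneg (frameOperator_nonneg f hf)).ringInverse

theorem inner_canonicalDual (i j : I) :
    inner ℂ (canonicalDual f hf i) (canonicalDual f hf j) =
      inner ℂ (f i) ((Ring.inverse (frameOperator f hf) *
        Ring.inverse (frameOperator f hf)) (f j)) :=
  (isSelfAdjoint_inverse_frameOperator f hf).isSymmetric _ _

theorem inner_canonicalParseval (i j : I) :
    inner ℂ (canonicalParseval f hf i) (canonicalParseval f hf j) =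
      inner ℂ (f i) (Ring.inverse (frameOperator f hf) (f j)) := by
  have hu := isUnit_frameOperator f hf
  have hsqrt : Ring.inverse (frameOperator f hf) =
      frameOperator f hf ^ (-(1 / 2) : ℝ) * frameOperator f hf ^ (-(1 / 2) : ℝ) := by
    rw [← CFC.rpow_add hu,
      CFC.inverse_eq_rpow_neg_one (hu.isStrictlyPositive (frameOperator_nonneg f hf))]
    norm_num
  rw [hsqrt]
  exact (IsSelfAdjoint.of_nonneg CFC.rpow_nonneg).isSymmetric _ _

theorem entry_analysis_comp [DecidableEq I] (D : H →L[ℂ] H) (i j : I) :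
    entry i j ((analysis f hf).comp (D.comp (analysis f hf).adjoint)) =
      inner ℂ (f i) (D (f j)) := by
  rw [← adjoint_analysis_single f hf j]
  rfl

variable {f} {G : Type*} [AddCommGroup G] {a : I → G} {K : ℕ}

theorem exists_summable_norm_inner_resolvent_le (hK : ∀ g, (a ⁻¹' {g}).encard ≤ K) {r : G → ℝ}
    (hr : Summable r) (hfr : ∀ i j, ‖inner ℂ (f i) (f j)‖ ≤ r (a i - a j)) {C : Set ℂ}
    (hC : IsCompact C) (h0 : 0 ∉ C) (hCS : C ⊆ resolventSet ℂ (frameOperator f hf)) :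
    ∃ s : G → ℝ, Summable s ∧ ∀ z ∈ C, ∀ i j,
      ‖inner ℂ (f i) (resolvent (frameOperator f hf) z (f j))‖ ≤ s (a i - a j) := by
  classical
  have hswap (z) (hz : z ∈ C) := resolvent_comp_swap (analysis f hf) (analysis f hf).adjoint
    (ne_of_mem_of_not_mem hz h0) (hCS hz)
  obtain ⟨s, hs, hres⟩ := exists_summable_norm_entry_resolvent_le hK hr
    (fun i j => (congrArg norm (entry_analysis_comp f hf 1 i j)).trans_le (hfr i j)) hC
    fun z hz => (hswap z hz).1
  obtain ⟨B, hB⟩ := hC.isBounded.exists_norm_le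
  refine ⟨fun g => B * s g + (Pi.single 0 1 : G → ℝ) g,
    (hs.mul_left B).add (hasSum_pi_single 0 1).summable, fun z hz i j => ?_⟩
  have hinner : inner ℂ (f i) (resolvent (frameOperator f hf) z (f j)) =
      z * entry i j (resolvent ((analysis f hf).comp (analysis f hf).adjoint) z)
        - if i = j then 1 else 0 := by
    rw [← smul_eq_mul, ← map_smul, (hswap z hz).2, map_add, entry_one, add_sub_cancel_left,
      entry_analysis_comp]
    rfl
  rw [hinner]
  refine (norm_sub_le _ _).trans (add_le_add ?_ ?_)
  · rw [norm_mul]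
    gcongr
    · exact (norm_nonneg _).trans (hB z hz)
    · exact hB z hz
    · exact hres z hz i j
  · split_ifs with hij
    · simp [hij]
    · rw [norm_zero]
      exact (Pi.single_nonneg (α := fun _ : G => ℝ)).2 zero_le_one _

end FrameOperator

section Multiplicity

variable {d e : ℕ} {α : Fin d → ℝ} {n : Fin e → ℕ}

theorem self_mem_box (N : ℕ) (j : RefGroup α n) : j ∈ box N j := by
  have : size (j - j) = 0 := by simp [size]
  rw [box, Set.mem_ofPred_eq, this]
  positivity

theorem encard_box (N : ℕ) (j : RefGroup α n) :
    (box N j).encard = (box N (0 : RefGroup α n)).encard := by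
  have : box N j = (· + j) '' box N (0 : RefGroup α n) := by
    ext k
    simp [box, sub_eq_add_neg]
  rw [this, (add_left_injective j).encard_image]

theorem exists_encard_preimage_singleton_le (hn : ∀ j, 0 < n j) {I : Type*} {a : I → RefGroup α n}
    (hD : upperDensity a < ⊤) : ∃ K : ℕ, ∀ g, (a ⁻¹' {g}).encard ≤ K := by
  obtain ⟨N, hN⟩ := (Filter.eventually_lt_of_limsup_lt hD).exists
  set C : ℝ≥0∞ := ⨆ j : RefGroup α n,
    ((a ⁻¹' box N j).encard : ℝ≥0∞) / ((box N j).encard : ℝ≥0∞)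
  have hbox := (box_finite hn N (0 : RefGroup α n)).encard_lt_top
  have hbox₀ : (box N (0 : RefGroup α n)).encard ≠ 0 :=
    Set.encard_ne_zero.2 ⟨0, self_mem_box N 0⟩
  obtain ⟨K, hK⟩ := ENNReal.exists_nat_gt
    (ENNReal.mul_lt_top hN (ENat.toENNReal_lt_top.2 hbox)).ne
  refine ⟨K, fun g => ?_⟩
  have hle : ((a ⁻¹' {g}).encard : ℝ≥0∞) ≤ K :=
    calc ((a ⁻¹' {g}).encard : ℝ≥0∞)
        ≤ (a ⁻¹' box N g).encard := by
          gcongr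
          exact Set.singleton_subset_iff.2 (self_mem_box N g)
      _ ≤ C * (box N (0 : RefGroup α n)).encard := by
          rw [← ENNReal.div_le_iff (by simpa using hbox₀) (by simpa using hbox.ne),
            ← encard_box N g]
          exact le_iSup (fun j => ((a ⁻¹' box N j).encard : ℝ≥0∞) / ((box N j).encard : ℝ≥0∞)) g
      _ ≤ K := hK.le
  exact_mod_cast hle

end Multiplicity

theorem exists_lp_one_bound {I G : Type*} [AddCommGroup G] {M : I → I → ℂ} {a : I → G} {r : G → ℝ}
    (hr : Summable r) (hM : ∀ i j, ‖M i j‖ ≤ r (a i - a j)) :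
    ∃ s : lp (fun _ : G => ℝ) 1, ∀ i j, ‖M i j‖ ≤ s (a i - a j) :=
  ⟨⟨r, memℓp_one_iff.2 hr.norm⟩, hM⟩

end LocalizedFrames

end

open LocalizedFrames in
theorem theorem2p9_general
    {H : Type*} [NormedAddCommGroup H] [InnerProductSpace ℂ H] [CompleteSpace H]
    {G : Type*} [AddCommGroup G] {I : Type*} (a : I → G) {K : ℕ}
    (hK : ∀ g, (a ⁻¹' {g}).encard ≤ K)
    (f : I → H) (hf : IsFrame f) (hloc : IsSelfLocalized 1 f a) :
    IsDualLocalized 1 f hf a ∧ IsSelfLocalized 1 (canonicalDual f hf) a ∧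
    IsSelfLocalized 1 (canonicalParseval f hf) a := by
  obtain ⟨r, hfr⟩ := hloc
  have h0 : (0 : ℂ) ∈ resolventSet ℂ (frameOperator f hf) := by
    simpa [spectrum.mem_resolventSet_iff] using isUnit_frameOperator f hf
  obtain ⟨ε, hε, hεS⟩ := Metric.nhds_basis_closedBall.mem_iff.1
    ((spectrum.isOpen_resolventSet _).mem_nhds h0)
  obtain ⟨s, hs, hres⟩ := exists_summable_norm_inner_resolvent_le hf hK
    (summable_norm_lp_one r).of_norm hfr (isCompact_sphere 0 ε) (by simpa using hε.ne)
    (Metric.sphere_subset_closedBall.trans hεS)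
  have hbound (i j) := norm_map_inverse_le_of_sphere hε hεS
    ((innerSL ℂ (f i)).comp (ContinuousLinearMap.apply ℂ H (f j))) fun z hz => hres z hz i j
  refine ⟨exists_lp_one_bound hs fun i j => (hbound i j).1,
    exists_lp_one_bound (hs.div_const ε) fun i j => ?_, exists_lp_one_bound hs fun i j => ?_⟩
  · rw [inner_canonicalDual]
    exact (hbound i j).2
  · rw [inner_canonicalParseval]
    exact (hbound i j).1

theorem theorem2p9
    {H : Type*} [NormedAddCommGroup H] [InnerProductSpace ℂ H] [CompleteSpace H]
    [TopologicalSpace.SeparableSpace H]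
    {d e : ℕ} (α : Fin d → ℝ) (hα : ∀ i, 0 < α i) (n : Fin e → ℕ) (hn : ∀ j, 0 < n j)
    {I : Type*} [Countable I] (a : I → LocalizedFrames.RefGroup α n)
    (hD : LocalizedFrames.upperDensity a < ⊤)
    (f : I → H) (hf : LocalizedFrames.IsFrame f)
    (hloc : LocalizedFrames.IsSelfLocalized 1 f a) :
    LocalizedFrames.IsDualLocalized 1 f hf a ∧
    LocalizedFrames.IsSelfLocalized 1 (LocalizedFrames.canonicalDual f hf) a ∧
    LocalizedFrames.IsSelfLocalized 1 (LocalizedFrames.canonicalParseval f hf) a := by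
  obtain ⟨K, hK⟩ := LocalizedFrames.exists_encard_preimage_singleton_le hn hD
  exact theorem2p9_general a hK f hf hloc
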